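/- Consider $n$ pursuers in the plane and a stationary target $T$. Pursuer $i$ has constant speed $V_i>0$, position $P_i=(x_i,y_i)$, heading angle $\gamma_i$ and lateral acceleration $a_i$, with $$\dot x_i=V_i\cos\gamma_i,\qquad \dot y_i=V_i\sin\gamma_i,\qquad \dot\gamma_i=a_i/V_i .$$ Let $R_i$ be the distance from $P_i$ to $T$, let $\theta_i\in(-\pi,\pi]$ be the lead angle, that is, the angle from the heading direction of $i$ to the line of sight from $P_i$ to $T$, and put $$\tilde t_i=\frac{R_i\theta_i}{V_i\sin\theta_i},\qquad a_i'=\frac{2V_i^2\sin\theta_i}{R_i}.$$ Here $a_i'$ is the lateral acceleration of the circular path from the current pose of $i$ to $T$, and $\tilde t_i$, the estimated time of interception, is the time needed along that path. Let $\mathcal G$ be a static digraph on $\{1,\dots,n\}$, and let $\mathcal N_{out}(i)$ be the set of out-neighbours of $i$. Suppose that $\theta_i(0)\notin\{0,\pi\}$ for all $i$, and that, as long as no pursuer has reached $T$, every pursuer follows the guidance law $$a_i=0\ \text{ if } \tilde t_i<\max_{j\in\mathcal N_{out}(i)}\tilde t_j,\qquad a_i=a_i'\ \text{ if } \tilde t_i\ge\max_{j\in\mathcal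 N_{out}(i)}\tilde t_j .$$ The equation for $\gamma_i$ is understood in integrated form, since $a_i$ switches. Sliding motions are also admitted: at a time when $\tilde t_i\ge\max_{j\in\mathcal N_{out}(i)}\tilde t_j$, $a_i$ may be any point of the segment between $0$ and $a_i'$, provided that a directed path leads from $i$, through pursuers that all have the same estimated time as $i$, to a pursuer whose estimated time is strictly smaller than that of one of its own out-neighbours. Positions depend continuously on time. Let $l$ be a leader, i.e. $\tilde t_l(0)=\max_{1\le i\le n}\tilde t_i(0)$, and suppose that $l$ is globally reachable: there is a directed path in $\mathcal G$ from every other node to $l$. Then there is a time $t_\alpha$ with $0\le t_\alpha<\tilde t_l(0)$ such that all pursuers move on circular trajectories during $[t_\alpha,\tilde t_l(0)]$: for every $i$, $a_i(t)=a_i'(t)$ for all $t\in[t_\alpha,\tilde t_l(0))$, and $P_i(t)$ stays for all $t\in[t_\alpha,\tilde t_l(0)]$ on one fixed circle of positive radius through $T$. Moreover, every pursuer is at $T$ at time $\tilde t_l(0)$ and none is at $T$ at an earlier time $t\in[0,\tilde t_l(0))$. -/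

import Mathlib

noncomputable section

/-- Motion data of `n` planar pursuers and a stationary target `(xT, yT)`: pursuer `i` has constant
speed `V i > 0` and, at time `t`, position `(x i t, y i t)`, heading angle `γ i t` and lateral
acceleration `a i t`. The equations that tie these together are in `Pursuit.FollowsGuidanceLaw`. -/
structure Pursuit (n : ℕ) where
  xT : ℝ
  yT : ℝ
  V : Fin n → ℝ
  V_pos : ∀ i, 0 < V i
  x : Fin n → ℝ → ℝ
  y : Fin n → ℝ → ℝ
  γ : Fin n → ℝ → ℝ
  a : Fin n → ℝ → ℝ

namespace Pursuit

variable {n : ℕ} (P : Pursuit n)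

/-- Line-of-sight vector from pursuer `i` to the target, as a complex number. -/
def los (i : Fin n) (t : ℝ) : ℂ := ⟨P.xT - P.x i t, P.yT - P.y i t⟩

/-- Distance of pursuer `i` to the target. -/
def R (i : Fin n) (t : ℝ) : ℝ := ‖P.los i t‖

/-- Lead angle of pursuer `i`: the angle in `(-π, π]` from its heading direction to the line of
sight. -/
def θ (i : Fin n) (t : ℝ) : ℝ :=
  Complex.arg (P.los i t * Complex.exp (-(P.γ i t : ℂ) * Complex.I))

/-- Estimated time of interception: the time that pursuer `i` needs to reach the target on the
circular path determined by its current pose. -/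
def tTilde (i : Fin n) (t : ℝ) : ℝ := P.R i t * P.θ i t / (P.V i * Real.sin (P.θ i t))

/-- Lateral acceleration that puts pursuer `i` on the circular path to the target. -/
def aCirc (i : Fin n) (t : ℝ) : ℝ := 2 * P.V i ^ 2 * Real.sin (P.θ i t) / P.R i t

/-- Pursuer `i` is at the target at time `t`. -/
def AtTarget (i : Fin n) (t : ℝ) : Prop := P.x i t = P.xT ∧ P.y i t = P.yT

/-- No pursuer has met the target during `[0, t]`. -/
def EnRoute (t : ℝ) : Prop := ∀ s ∈ Set.Icc 0 t, ∀ i, ¬ P.AtTarget i s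

/-- `t̃_i` is strictly smaller than the maximum of `t̃_j` over the out-neighbours `j` of `i`. -/
def Below (G : Digraph (Fin n)) (i : Fin n) (t : ℝ) : Prop :=
  ∃ j, G.Adj i j ∧ P.tTilde i t < P.tTilde j t

/-- At time `t` pursuer `i` is tied, directly or through a directed path of pursuers that all have
the same estimated time, with a pursuer that is strictly below one of its out-neighbours and hence
moves straight. This is the situation in which the guidance law may make `i` alternate infinitely
fast between straight and circular motion. -/
def TiedToStraight (G : Digraph (Fin n)) (i : Fin n) (t : ℝ) : Prop :=
  ∃ k, Relation.ReflTransGen (fun p q => G.Adj p q ∧ P.tTilde p t = P.tTilde q t) i k ∧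
    P.Below G k t

/-- The guidance law for pursuer `i` at time `t` on the graph `G`: no lateral acceleration if `t̃_i`
is smaller than the maximum of `t̃_j` over the out-neighbours, and the acceleration `aCirc` of the
circular path otherwise. The last alternative only adds motions: for a pursuer that is tied to a
straight-moving one it also admits the averaged acceleration of an infinitely fast alternation
between the two modes (sliding motion). -/
structure GuidanceLawAt (G : Digraph (Fin n)) (i : Fin n) (t : ℝ) : Prop where
  straight : P.Below G i t → P.a i t = 0
  circular : ¬ P.Below G i t →
    P.a i t = P.aCirc i t ∨
      (P.TiedToStraight G i t ∧ P.a i t ∈ segment ℝ 0 (P.aCirc i t))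

/-- The pursuers move continuously and, as long as none of them has met the target, obey the unicycle
equations `x' = V cos γ`, `y' = V sin γ`, `γ' = a / V` under the guidance law on the static graph
`G`. As `a` switches, the last equation is in integrated form. -/
structure FollowsGuidanceLaw (G : Digraph (Fin n)) : Prop where
  continuousOn_x : ∀ i, ContinuousOn (P.x i) (Set.Ici 0)
  continuousOn_y : ∀ i, ContinuousOn (P.y i) (Set.Ici 0)
  x_eq : ∀ i t, 0 ≤ t → P.EnRoute t →
    HasDerivWithinAt (P.x i) (P.V i * Real.cos (P.γ i t)) (Set.Ici 0) t
  y_eq : ∀ i t, 0 ≤ t → P.EnRoute t →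
    HasDerivWithinAt (P.y i) (P.V i * Real.sin (P.γ i t)) (Set.Ici 0) t
  integrable_a : ∀ i t, 0 ≤ t → P.EnRoute t →
    IntervalIntegrable (P.a i) MeasureTheory.volume 0 t
  γ_eq : ∀ i t, 0 ≤ t → P.EnRoute t →
    P.γ i t = P.γ i 0 + ∫ s in (0 : ℝ)..t, P.a i s / P.V i
  law : ∀ i t, 0 ≤ t → P.EnRoute t → P.GuidanceLawAt G i t

/-- Pursuer `l` is a leader at time `t`: it has the largest estimated time of interception. -/
def IsLeader (l : Fin n) (t : ℝ) : Prop := ∀ i, P.tTilde i t ≤ P.tTilde l t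

/-- During `[t₁, t₂]` pursuer `i` moves on the circular path to the target, which it reaches at time
`t₂`: it applies the acceleration `aCirc` before `t₂`, and its positions lie on one fixed circle that
passes through the target. -/
def CircularToTarget (i : Fin n) (t₁ t₂ : ℝ) : Prop :=
  (∀ t ∈ Set.Ico t₁ t₂, P.a i t = P.aCirc i t) ∧
  (∃ cx cy r : ℝ, 0 < r ∧ (P.xT - cx) ^ 2 + (P.yT - cy) ^ 2 = r ^ 2 ∧
    ∀ t ∈ Set.Icc t₁ t₂, (P.x i t - cx) ^ 2 + (P.y i t - cy) ^ 2 = r ^ 2) ∧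
  P.AtTarget i t₂

end Pursuit

/-- There is a directed path in `G` from every other node to `l`. -/
def GloballyReachable {n : ℕ} (G : Digraph (Fin n)) (l : Fin n) : Prop :=
  ∀ j, j ≠ l → Relation.ReflTransGen G.Adj j l

end

section

open Set Filter Topology MeasureTheory

/-! In the body frame the line of sight `w` obeys `w' = -V - iωw`, where the law makes `ω` a
fraction `κ ∈ [0, 1]` of the turn rate of the circular path. Then `arrival = tTilde + t` has
derivative `2(1 - κ)(1 - θ cot θ) ≥ 0`, which vanishes for `κ = 1`. A leader always has `κ = 1`, so
the largest arrival estimate stays at its initial value `t_f` (`arrival_le_leader`).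

Three facts govern meeting the target. An estimate that stays at most `τ` forces presence at `τ`,
because the chord is at most the arc (`atTarget_of_arrival_le`). An estimate above `τ` forbids it
(`not_atTarget_of_lt_arrival`). Straight motion misses the target, because its line stays at a fixed
nonzero distance from it (`not_atTarget_of_straight`).

Induction along paths to `l` finishes the argument. If `p` met the target at `τ < t_f` while its
out-neighbour `q` did not, `q` would eventually have the larger estimate, so `p` would fly straight
and miss. The same conflict at `t_f` makes every estimate equal `t_f` from some earlier time on.
Then all pursuers are leaders, hence all turn on circles. -/

/-! ### Monotonicity from almost everywhere derivatives -/

/-- Accelerations switch, so derivatives exist only almost everywhere; Lipschitz regularity is what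
passes to smooth functions of the state. Smoothness is asked only along the curve because
`circularTime` is singular on the real axis. -/
theorem LocallyLipschitzOn.contDiffAt_comp {E F : Type*} [NormedAddCommGroup E] [NormedSpace ℝ E]
    [NormedAddCommGroup F] [NormedSpace ℝ F] {f : E → F} {c : ℝ → E} {s : Set ℝ}
    (hc : LocallyLipschitzOn s c) (hf : ∀ t ∈ s, ContDiffAt ℝ 1 f (c t)) :
    LocallyLipschitzOn s (fun t => f (c t)) := by
  intro t ht
  obtain ⟨K, u, hu, hK⟩ := hc ht
  obtain ⟨L, v, hv, hL⟩ := (hf t ht).exists_lipschitzOnWith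
  refine ⟨L * K, u ∩ c ⁻¹' v, inter_mem hu (hc.continuousOn t ht hv), ?_⟩
  exact hL.comp (hK.mono inter_subset_left) fun x hx => hx.2

theorem LocallyLipschitzOn.prodMk {α E F : Type*} [PseudoMetricSpace α] [PseudoMetricSpace E]
    [PseudoMetricSpace F] {f : α → E} {g : α → F} {s : Set α}
    (hf : LocallyLipschitzOn s f) (hg : LocallyLipschitzOn s g) :
    LocallyLipschitzOn s (fun t => (f t, g t)) := by
  intro t ht
  obtain ⟨K, u, hu, hK⟩ := hf ht
  obtain ⟨L, v, hv, hL⟩ := hg ht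
  exact ⟨max K L, u ∩ v, inter_mem hu hv,
    (hK.mono inter_subset_left).prodMk (hL.mono inter_subset_right)⟩

theorem LipschitzOnWith.locallyLipschitzOn {α E : Type*} [PseudoMetricSpace α]
    [PseudoMetricSpace E] {f : α → E} {s : Set α} {K : NNReal} (hf : LipschitzOnWith K f s) :
    LocallyLipschitzOn s f :=
  fun _ _ => ⟨K, s, self_mem_nhdsWithin, hf⟩

/-- A locally Lipschitz function on an interval whose derivative is almost everywhere nonnegative
does not decrease. -/
theorem LocallyLipschitzOn.le_of_ae_deriv_nonneg {f : ℝ → ℝ} {a b : ℝ} (hab : a ≤ b)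
    (hf : LocallyLipschitzOn (Icc a b) f)
    (hd : ∀ᵐ t, t ∈ Ioo a b → ∃ d, 0 ≤ d ∧ HasDerivAt f d t) : f a ≤ f b := by
  obtain ⟨K, hK⟩ := hf.exists_lipschitzOnWith_of_compact isCompact_Icc
  rw [← uIcc_of_le hab] at hK
  have h := hK.absolutelyContinuousOnInterval.integral_deriv_eq_sub
  have h0 : 0 ≤ ∫ t in a..b, deriv f t := by
    rw [intervalIntegral.integral_of_le hab, integral_Ioc_eq_integral_Ioo]
    refine setIntegral_nonneg_of_ae_restrict ?_
    rw [EventuallyLE, ae_restrict_iff' measurableSet_Ioo]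
    filter_upwards [hd] with t ht hm
    obtain ⟨d, h0, h1⟩ := ht hm
    rwa [h1.deriv]
  linarith

/-- A locally Lipschitz function on an interval whose derivative vanishes almost everywhere has the
same value at both ends. -/
theorem LocallyLipschitzOn.eq_of_ae_deriv_zero {E : Type*} [NormedAddCommGroup E] [NormedSpace ℝ E]
    {f : ℝ → E} {a b : ℝ} (hab : a ≤ b) (hf : LocallyLipschitzOn (Icc a b) f)
    (hd : ∀ᵐ t, t ∈ Ioo a b → HasDerivAt f 0 t) : f b = f a := by
  obtain ⟨K, hK⟩ := hf.exists_lipschitzOnWith_of_compact isCompact_Icc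
  rw [← uIcc_of_le hab] at hK
  obtain ⟨C, hC⟩ := hK.absolutelyContinuousOnInterval.const_of_ae_hasDerivAt_zero (by
    rw [uIcc_of_le hab]
    filter_upwards [hd, Ioo_ae_eq_Icc (μ := volume) (a := a) (b := b)] with t h1 h2 h3
    exact h1 (h2.mpr h3))
  rw [hC a left_mem_uIcc, hC b right_mem_uIcc]

/-- If almost everywhere the functions attaining the maximum of finitely many locally Lipschitz
functions have derivative zero, then the maximum stays constant. -/
theorem LocallyLipschitzOn.norm_eq_of_ae_deriv_zero {ι : Type*} [Fintype ι] {u : ι → ℝ → ℝ}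
    {a b : ℝ} (hab : a ≤ b) (hu : ∀ i, LocallyLipschitzOn (Icc a b) (u i))
    (hpos : ∀ i, ∀ t ∈ Icc a b, 0 ≤ u i t)
    (hd : ∀ᵐ t, t ∈ Ioo a b → ∀ i, (∀ j, u j t ≤ u i t) → HasDerivAt (u i) 0 t) :
    ‖(fun i => u i b)‖ = ‖(fun i => u i a)‖ := by
  choose K hK using fun i => (hu i).exists_lipschitzOnWith_of_compact isCompact_Icc
  set m : ℝ → ℝ := fun t => ‖(fun i => u i t)‖ with hm
  obtain ⟨C, hC⟩ : ∃ C, ∀ i, K i ≤ C := ⟨Finset.univ.sup K, fun i => Finset.le_sup (Finset.mem_univ i)⟩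
  have hmL : LipschitzOnWith C m (Icc a b) := by
    refine LipschitzOnWith.of_dist_le_mul fun s hs t ht => ?_
    refine (dist_norm_norm_le _ _).trans ?_
    refine (pi_norm_le_iff_of_nonneg (by positivity)).2 fun i => ?_
    have := ((hK i).weaken (hC i)).dist_le_mul s hs t ht
    simpa [dist_eq_norm] using this
  have hle : ∀ t ∈ Icc a b, ∀ i, u i t ≤ m t := fun t ht i => by
    have := norm_le_pi_norm (fun i => u i t) i
    rwa [Real.norm_of_nonneg (hpos i t ht)] at this
  have hmd := hmL.ae_differentiableWithinAt_of_mem_real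
  have hz : ∀ᵐ t, t ∈ Ioo a b → HasDerivAt m 0 t := by
    filter_upwards [hmd, hd] with t h1 h2 ht
    have hn : Icc a b ∈ 𝓝 t := Icc_mem_nhds ht.1 ht.2
    have h3 := ((h1 (Ioo_subset_Icc_self ht)).differentiableAt hn).hasDerivAt
    rcases isEmpty_or_nonempty ι with he | hne
    · have : m = fun _ => 0 := by
        funext s; simp only [hm]; rw [Subsingleton.elim (fun i => u i s) 0, norm_zero]
      rw [this]; exact hasDerivAt_const _ _
    obtain ⟨i, hi⟩ := Finite.exists_max fun i => u i t
    have hmi : m t = u i t := by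
      refine le_antisymm ?_ (hle t (Ioo_subset_Icc_self ht) i)
      refine (pi_norm_le_iff_of_nonneg (hpos i t (Ioo_subset_Icc_self ht))).2 fun j => ?_
      rw [Real.norm_of_nonneg (hpos j t (Ioo_subset_Icc_self ht))]
      exact hi j
    have hui := h2 ht i hi
    -- The maximum dominates `u i` and touches it at `t`, so the two derivatives agree there.
    have hmin : IsLocalMin (fun s => m s - u i s) t := by
      filter_upwards [hn] with s hs
      rw [hmi, sub_self]
      exact sub_nonneg.2 (hle s hs i)
    have := hmin.hasDerivAt_eq_zero (h3.sub hui)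
    rw [sub_zero] at this
    rwa [this] at h3
  exact LocallyLipschitzOn.eq_of_ae_deriv_zero hab hmL.locallyLipschitzOn hz

/-! ### Geometry of the circular path -/

theorem mul_cos_le_sin {x : ℝ} (h0 : 0 < x) (hpi : x < Real.pi) : x * Real.cos x ≤ Real.sin x := by
  rcases lt_or_ge x (Real.pi / 2) with h | h
  · have hc := Real.cos_pos_of_mem_Ioo ⟨by linarith, h⟩
    have := (Real.lt_tan h0 h).le
    rwa [Real.tan_eq_sin_div_cos, le_div_iff₀ hc] at this
  · have hc := Real.cos_nonpos_of_pi_div_two_le_of_le h (by linarith)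
    have := Real.sin_pos_of_pos_of_lt_pi h0 hpi
    nlinarith

namespace Complex

/-- This is `θ cot θ ≤ 1`; evenness in `θ` reduces it to `0 < θ < π`. It fixes the sign of the drift
of the estimates. -/
theorem re_mul_arg_div_im_le_one {w : ℂ} (hw : w.im ≠ 0) : w.re * w.arg / w.im ≤ 1 := by
  have hn : 0 < ‖w‖ := norm_pos_iff.2 fun h => hw (by simp [h])
  have hre : w.re = ‖w‖ * Real.cos w.arg := (norm_mul_cos_arg w).symm
  have him : w.im = ‖w‖ * Real.sin w.arg := (norm_mul_sin_arg w).symm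
  have hs : Real.sin w.arg ≠ 0 := fun h => hw (by rw [him, h, mul_zero])
  have hne : w.arg ≠ Real.pi := fun h => hs (by rw [h, Real.sin_pi])
  have hlt := lt_of_le_of_ne (arg_le_pi w) hne
  rw [show w.re * w.arg / w.im = w.arg * Real.cos w.arg / Real.sin w.arg by
    rw [hre, him]; field_simp]
  rcases lt_trichotomy 0 w.arg with h | h | h
  · rw [div_le_one (Real.sin_pos_of_pos_of_lt_pi h hlt)]
    exact mul_cos_le_sin h hlt
  · exact absurd (by rw [← h, Real.sin_zero]) hs
  · have h1 := mul_cos_le_sin (neg_pos.2 h) (by linarith [neg_pi_lt_arg w])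
    rw [Real.cos_neg, Real.sin_neg] at h1
    rw [div_le_one_of_neg (Real.sin_neg_of_neg_of_neg_pi_lt h (neg_pi_lt_arg w))]
    linarith

end Complex

/-- Time needed to reach the target at speed `V` along the circular path, when the target is at `w`
in the frame in which the pursuer sits at `0` and heads along the positive real axis. -/
noncomputable def circularTime (V : ℝ) (w : ℂ) : ℝ := Complex.normSq w * w.arg / (V * w.im)

theorem contDiffAt_circularTime {V : ℝ} (hV : 0 < V) {w : ℂ} (hw : w.im ≠ 0) :
    ContDiffAt ℝ 1 (circularTime V) w := by
  have h1 : ContDiffAt ℝ 1 (fun z : ℂ => z.im) w := Complex.imCLM.contDiff.contDiffAt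
  have h2 : ContDiffAt ℝ 1 (fun z : ℂ => z.re) w := Complex.reCLM.contDiff.contDiffAt
  have h3 : ContDiffAt ℝ 1 (fun z : ℂ => z.arg) w := by
    have h : ContDiffAt ℝ 1 Complex.log w :=
      (Complex.contDiffAt_log (Complex.mem_slitPlane_iff.2 (Or.inr hw))).restrict_scalars ℝ
    have := Complex.imCLM.contDiff.contDiffAt.comp w h
    refine this.congr_of_eventuallyEq (Eventually.of_forall fun z => ?_)
    simp [Complex.log_im]
  have h4 : ContDiffAt ℝ 1 (fun z : ℂ => Complex.normSq z) w := by
    simp only [Complex.normSq_apply]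
    exact (h2.mul h2).add (h1.mul h1)
  exact (h4.mul h3).div (contDiffAt_const.mul h1) (mul_ne_zero hV.ne' hw)

/-- Here `κ` interpolates between straight motion (`0`) and the circular path (`1`), along which the
remaining time decreases at unit rate. -/
theorem hasDerivAt_circularTime {V κ ω : ℝ} (hV : 0 < V) {w : ℝ → ℂ} {t : ℝ} (hw : (w t).im ≠ 0)
    (hω : ω = κ * (2 * V * (w t).im / Complex.normSq (w t)))
    (hd : HasDerivAt w (-V - Complex.I * ω * w t) t) :
    HasDerivAt (fun s => circularTime V (w s))
      (-1 + 2 * (1 - κ) * (1 - (w t).re * (w t).arg / (w t).im)) t := by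
  have hn : Complex.normSq (w t) ≠ 0 := fun h => hw (by rw [Complex.normSq_eq_zero.1 h]; simp)
  have him := Complex.imCLM.hasFDerivAt.comp_hasDerivAt t hd
  have hre := Complex.reCLM.hasFDerivAt.comp_hasDerivAt t hd
  have harg := Complex.imCLM.hasFDerivAt.comp_hasDerivAt t
    (hd.clog_real (Complex.mem_slitPlane_iff.2 (Or.inr hw)))
  have hsq := (hre.mul hre).add (him.mul him)
  have := (hsq.mul harg).div (him.const_mul V) (mul_ne_zero hV.ne' hw)
  refine (this.congr_deriv ?_).congr_of_eventuallyEq (Eventually.of_forall fun s => ?_)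
  · simp [Complex.div_im, Complex.log_im]
    rw [hω]
    rw [Complex.normSq_apply] at hn ⊢
    field_simp
    ring
  · simp [circularTime, Complex.normSq_apply, Complex.log_im]

theorem mul_circularTime_eq {V : ℝ} (hV : 0 < V) {w : ℂ} (hw : w.im ≠ 0) :
    0 < Real.sin |w.arg| ∧ V * circularTime V w = ‖w‖ * (|w.arg| / Real.sin |w.arg|) := by
  have hn : ‖w‖ ≠ 0 := fun h => hw (by rw [norm_eq_zero.1 h]; rfl)
  have him : w.im = ‖w‖ * Real.sin w.arg := (Complex.norm_mul_sin_arg w).symm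
  have hs : Real.sin w.arg ≠ 0 := fun h => hw (by rw [him, h, mul_zero])
  have hne : w.arg ≠ Real.pi := fun h => hs (by rw [h, Real.sin_pi])
  have hlt := lt_of_le_of_ne (Complex.arg_le_pi w) hne
  have h : V * circularTime V w = ‖w‖ * (w.arg / Real.sin w.arg) := by
    rw [circularTime, him, Complex.normSq_eq_norm_sq]
    field_simp
  rcases lt_trichotomy 0 w.arg with h0 | h0 | h0
  · rw [abs_of_pos h0]
    exact ⟨Real.sin_pos_of_pos_of_lt_pi h0 hlt, h⟩
  · exact absurd (by rw [← h0, Real.sin_zero]) hs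
  · rw [abs_of_neg h0]
    refine ⟨Real.sin_pos_of_pos_of_lt_pi (neg_pos.2 h0) (by linarith [Complex.neg_pi_lt_arg w]), ?_⟩
    rw [h, Real.sin_neg, neg_div_neg_eq]

/-- The arc is at least as long as its chord. -/
theorem norm_le_mul_circularTime {V : ℝ} (hV : 0 < V) {w : ℂ} (hw : w.im ≠ 0) :
    ‖w‖ ≤ V * circularTime V w := by
  obtain ⟨hs, h⟩ := mul_circularTime_eq hV hw
  rw [h]
  exact le_mul_of_one_le_right (norm_nonneg _)
    ((one_le_div hs).2 (Real.sin_le (abs_nonneg _)))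

/-- A target not behind the pursuer is reached within a half circle, so Jordan's inequality bounds
arc over chord by `π / 2`. -/
theorem mul_circularTime_le {V : ℝ} (hV : 0 < V) {w : ℂ} (hw : w.im ≠ 0) (hre : 0 ≤ w.re) :
    V * circularTime V w ≤ ‖w‖ * (Real.pi / 2) := by
  obtain ⟨hs, h⟩ := mul_circularTime_eq hV hw
  rw [h]
  refine mul_le_mul_of_nonneg_left ?_ (norm_nonneg _)
  rw [div_le_iff₀ hs]
  have := Real.mul_le_sin (abs_nonneg _) (Complex.abs_arg_le_pi_div_two_iff.2 hre)
  have hpi := Real.pi_pos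
  calc |w.arg| = Real.pi / 2 * (2 / Real.pi * |w.arg|) := by field_simp
    _ ≤ _ := by gcongr

/-! ### Motion in the body frame -/

namespace Pursuit

variable {n : ℕ} {P : Pursuit n} {G : Digraph (Fin n)} {i : Fin n} {s t T : ℝ}

/-- Line-of-sight vector of pursuer `i` in its body frame, whose real axis is the heading. -/
noncomputable def bodyLos (P : Pursuit n) (i : Fin n) (t : ℝ) : ℂ :=
  P.los i t * Complex.exp (-(P.γ i t : ℂ) * Complex.I)

/-- Angular velocity of pursuer `i`. -/
noncomputable def turnRate (P : Pursuit n) (i : Fin n) (t : ℝ) : ℝ := P.a i t / P.V i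

theorem norm_bodyLos (i : Fin n) (t : ℝ) : ‖P.bodyLos i t‖ = P.R i t := by
  rw [bodyLos, norm_mul, ← Complex.ofReal_neg, Complex.norm_exp_ofReal_mul_I, mul_one, R]

theorem tTilde_eq_circularTime (i : Fin n) (t : ℝ) :
    P.tTilde i t = circularTime (P.V i) (P.bodyLos i t) := by
  have h : P.θ i t = (P.bodyLos i t).arg := rfl
  rw [tTilde, h, Complex.sin_arg, circularTime, Complex.normSq_eq_norm_sq, norm_bodyLos]
  rcases eq_or_ne (P.R i t) 0 with h0 | h0
  · simp [h0]
  · rw [← mul_div_assoc, div_div_eq_mul_div]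
    ring_nf

theorem aCirc_div (i : Fin n) (t : ℝ) :
    P.aCirc i t / P.V i = 2 * P.V i * (P.bodyLos i t).im / Complex.normSq (P.bodyLos i t) := by
  have h : P.θ i t = (P.bodyLos i t).arg := rfl
  have hV := (P.V_pos i).ne'
  rw [aCirc, h, Complex.sin_arg, Complex.normSq_eq_norm_sq, norm_bodyLos]
  rcases eq_or_ne (P.R i t) 0 with h0 | h0
  · simp [h0]
  · field_simp

theorem atTarget_iff : P.AtTarget i t ↔ P.los i t = 0 := by
  rw [AtTarget, los, Complex.ext_iff]
  simp only [Complex.zero_re, Complex.zero_im, sub_eq_zero]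
  exact and_congr eq_comm eq_comm

theorem EnRoute.mono (h : P.EnRoute t) (hs : s ≤ t) : P.EnRoute s :=
  fun r hr => h r ⟨hr.1, hr.2.trans hs⟩

theorem EnRoute.los_ne_zero (h : P.EnRoute T) (ht : t ∈ Icc 0 T) : P.los i t ≠ 0 :=
  fun h0 => h t ht i (atTarget_iff.2 h0)

theorem EnRoute.bodyLos_ne_zero (h : P.EnRoute T) (ht : t ∈ Icc 0 T) : P.bodyLos i t ≠ 0 :=
  mul_ne_zero (h.los_ne_zero ht) (Complex.exp_ne_zero _)

namespace FollowsGuidanceLaw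

theorem continuousOn_los (hG : P.FollowsGuidanceLaw G) : ContinuousOn (P.los i) (Ici 0) := by
  have h : P.los i = fun t => ((P.xT - P.x i t : ℝ) : ℂ) + ((P.yT - P.y i t : ℝ) : ℂ) * Complex.I := by
    funext t
    exact (Complex.mk_eq_add_mul_I _ _)
  rw [h]
  have hx := continuousOn_const (c := P.xT) |>.sub (hG.continuousOn_x i)
  have hy := continuousOn_const (c := P.yT) |>.sub (hG.continuousOn_y i)
  exact (Complex.continuous_ofReal.comp_continuousOn hx).add
    ((Complex.continuous_ofReal.comp_continuousOn hy).mul continuousOn_const)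

theorem hasDerivWithinAt_los (hG : P.FollowsGuidanceLaw G) (h0 : 0 ≤ t) (ht : P.EnRoute t) :
    HasDerivWithinAt (P.los i) (-(P.V i * Complex.exp (P.γ i t * Complex.I))) (Ici 0) t := by
  have hx := ((hG.x_eq i t h0 ht).const_sub P.xT).ofReal_comp
  have hy := ((hG.y_eq i t h0 ht).const_sub P.yT).ofReal_comp
  refine ((hx.add (hy.mul_const Complex.I)).congr_deriv ?_).congr_of_eventuallyEq
    (Eventually.of_forall fun s => ?_) ?_
  · rw [Complex.exp_mul_I]
    push_cast
    ring
  · exact Complex.mk_eq_add_mul_I _ _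
  · exact Complex.mk_eq_add_mul_I _ _

/-- Straight, circular and sliding motion are `κ = 0`, `κ = 1` and a `κ` in between; this form lets
the estimates treat them together. -/
theorem exists_turnRate_eq (hG : P.FollowsGuidanceLaw G) (h0 : 0 ≤ t) (ht : P.EnRoute t) :
    ∃ κ ∈ Icc (0 : ℝ) 1, P.turnRate i t =
      κ * (2 * P.V i * (P.bodyLos i t).im / Complex.normSq (P.bodyLos i t)) := by
  obtain ⟨h1, h2⟩ := hG.law i t h0 ht
  rw [← aCirc_div, turnRate]
  by_cases hb : P.Below G i t
  · exact ⟨0, by simp, by rw [h1 hb]; simp⟩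
  · rcases h2 hb with h | ⟨-, h⟩
    · exact ⟨1, by simp, by rw [h]; simp⟩
    · rw [segment_eq_image] at h
      obtain ⟨κ, hκ, h⟩ := h
      refine ⟨κ, hκ, ?_⟩
      rw [← h]
      simp [mul_div_assoc]

theorem exists_pos_le_R (hG : P.FollowsGuidanceLaw G) (h0 : 0 ≤ T) (hT : P.EnRoute T) (i : Fin n) :
    ∃ ρ > 0, ∀ t ∈ Icc 0 T, ρ ≤ P.R i t := by
  have hc : ContinuousOn (P.R i) (Icc 0 T) := (hG.continuousOn_los.mono Icc_subset_Ici_self).norm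
  obtain ⟨t, ht, hm⟩ := isCompact_Icc.exists_isMinOn (nonempty_Icc.2 h0) hc
  exact ⟨P.R i t, norm_pos_iff.2 (hT.los_ne_zero ht), fun s hs => hm hs⟩

theorem abs_turnRate_le (hG : P.FollowsGuidanceLaw G) (h0 : 0 ≤ t) (ht : P.EnRoute t) :
    |P.turnRate i t| ≤ 2 * P.V i / P.R i t := by
  obtain ⟨κ, hκ, h⟩ := hG.exists_turnRate_eq (i := i) h0 ht
  have hV := P.V_pos i
  have hR : 0 < P.R i t := norm_pos_iff.2 (ht.los_ne_zero ⟨h0, le_rfl⟩)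
  rw [h, Complex.normSq_eq_norm_sq, norm_bodyLos, abs_mul, abs_div, abs_mul, abs_of_nonneg hκ.1,
    abs_of_pos (by positivity : 0 < 2 * P.V i), abs_of_pos (by positivity : 0 < P.R i t ^ 2)]
  have him := Complex.abs_im_le_norm (P.bodyLos i t)
  rw [norm_bodyLos] at him
  calc κ * (2 * P.V i * |(P.bodyLos i t).im| / P.R i t ^ 2)
      ≤ 1 * (2 * P.V i * P.R i t / P.R i t ^ 2) := by
        have := hκ.2
        gcongr
    _ = 2 * P.V i / P.R i t := by field_simp

theorem locallyLipschitzOn_los (hG : P.FollowsGuidanceLaw G) (hT : P.EnRoute T) :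
    LocallyLipschitzOn (Icc 0 T) (P.los i) := by
  have hV := P.V_pos i
  refine (Convex.lipschitzOnWith_of_nnnorm_hasDerivWithin_le (C := (P.V i).toNNReal)
    (convex_Icc 0 T) (fun t ht => (hG.hasDerivWithinAt_los ht.1 (hT.mono ht.2)).mono
      Icc_subset_Ici_self) fun t ht => ?_).locallyLipschitzOn
  rw [← NNReal.coe_le_coe, coe_nnnorm, norm_neg, norm_mul, Complex.norm_exp_ofReal_mul_I]
  simp [hV.le, abs_of_pos hV]

theorem intervalIntegrable_turnRate (hG : P.FollowsGuidanceLaw G) (h0 : 0 ≤ T)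
    (hT : P.EnRoute T) : IntervalIntegrable (P.turnRate i) volume 0 T :=
  (hG.integrable_a i T h0 hT).div_const _

/-- By compactness the distance to the target has a positive lower bound on `[0, T]`, which bounds
the turn rate. -/
theorem locallyLipschitzOn_γ (hG : P.FollowsGuidanceLaw G) (h0 : 0 ≤ T) (hT : P.EnRoute T) :
    LocallyLipschitzOn (Icc 0 T) (P.γ i) := by
  obtain ⟨ρ, hρ, hρR⟩ := hG.exists_pos_le_R h0 hT i
  have hV := P.V_pos i
  have hI := hG.intervalIntegrable_turnRate (i := i) h0 hT
  refine (LipschitzOnWith.of_dist_le_mul (K := (2 * P.V i / ρ).toNNReal)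
    fun s hs t ht => ?_).locallyLipschitzOn
  have hsub : ∀ r ∈ Icc 0 T, IntervalIntegrable (P.turnRate i) volume 0 r := fun r hr =>
    hI.mono_set (by rw [uIcc_of_le h0, uIcc_of_le hr.1]; exact Icc_subset_Icc_right hr.2)
  have : P.γ i s - P.γ i t = ∫ r in t..s, P.turnRate i r := by
    rw [hG.γ_eq i s hs.1 (hT.mono hs.2), hG.γ_eq i t ht.1 (hT.mono ht.2), add_sub_add_left_eq_sub]
    exact intervalIntegral.integral_interval_sub_left (hsub s hs) (hsub t ht)
  rw [Real.dist_eq, this, Real.dist_eq, Real.coe_toNNReal _ (by positivity), ← Real.norm_eq_abs]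
  refine intervalIntegral.norm_integral_le_of_norm_le_const (E := ℝ) fun r hr => ?_
  have hr' : r ∈ Icc 0 T := by
    have := uIoc_subset_uIcc hr
    exact uIcc_subset_Icc ht hs this
  refine (hG.abs_turnRate_le hr'.1 (hT.mono hr'.2)).trans ?_
  have := hρR r hr'
  gcongr

theorem ae_hasDerivAt_γ (hG : P.FollowsGuidanceLaw G) (h0 : 0 ≤ T) (hT : P.EnRoute T) :
    ∀ᵐ t, t ∈ Ioo 0 T → HasDerivAt (P.γ i) (P.turnRate i t) t := by
  filter_upwards [(hG.intervalIntegrable_turnRate (i := i) h0 hT).ae_hasDerivAt_integral]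
    with t h ht
  rw [uIcc_of_le h0] at h
  refine ((h (Ioo_subset_Icc_self ht) 0 ⟨le_rfl, h0⟩).const_add (P.γ i 0)).congr_of_eventuallyEq ?_
  filter_upwards [Ioo_mem_nhds ht.1 ht.2] with s hs
  exact hG.γ_eq i s hs.1.le (hT.mono hs.2.le)

theorem locallyLipschitzOn_bodyLos (hG : P.FollowsGuidanceLaw G) (h0 : 0 ≤ T)
    (hT : P.EnRoute T) : LocallyLipschitzOn (Icc 0 T) (P.bodyLos i) := by
  refine ((hG.locallyLipschitzOn_los hT).prodMk (hG.locallyLipschitzOn_γ h0 hT)).contDiffAt_comp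
    (f := fun p : ℂ × ℝ => p.1 * Complex.exp (-(p.2 : ℂ) * Complex.I)) fun t _ => ?_
  have h : ContDiff ℝ 1 fun p : ℂ × ℝ => (p.2 : ℂ) :=
    Complex.ofRealCLM.contDiff.comp contDiff_snd
  exact (contDiff_fst.mul (h.neg.mul contDiff_const).cexp).contDiffAt

theorem hasDerivAt_bodyLos (hG : P.FollowsGuidanceLaw G) {ω : ℝ} (ht : t ∈ Ioo 0 T)
    (hT : P.EnRoute T) (hγ : HasDerivAt (P.γ i) ω t) :
    HasDerivAt (P.bodyLos i) (-P.V i - Complex.I * ω * P.bodyLos i t) t := by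
  have h1 := (hG.hasDerivWithinAt_los (i := i) ht.1.le (hT.mono ht.2.le)).hasDerivAt
    (Ici_mem_nhds ht.1)
  have h2 := (hγ.ofReal_comp.neg.mul_const Complex.I).cexp
  refine (h1.mul h2).congr_deriv ?_
  have h3 : Complex.exp (P.γ i t * Complex.I) * Complex.exp (-(P.γ i t : ℂ) * Complex.I) = 1 := by
    rw [← Complex.exp_add]; simp
  rw [bodyLos]
  linear_combination (-(P.V i : ℂ)) * h3

theorem ae_hasDerivAt_bodyLos (hG : P.FollowsGuidanceLaw G) (h0 : 0 ≤ T) (hT : P.EnRoute T) :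
    ∀ᵐ t, t ∈ Ioo 0 T → HasDerivAt (P.bodyLos i)
      (-P.V i - Complex.I * P.turnRate i t * P.bodyLos i t) t := by
  filter_upwards [hG.ae_hasDerivAt_γ (i := i) h0 hT] with t h ht
  exact hG.hasDerivAt_bodyLos ht hT (h ht)

theorem hasDerivAt_bodyLos_im {V ω : ℝ} {w : ℝ → ℂ}
    (h : HasDerivAt w (-V - Complex.I * ω * w t) t) :
    HasDerivAt (fun s => (w s).im) (-(ω * (w t).re)) t := by
  refine (Complex.imCLM.hasFDerivAt.comp_hasDerivAt t h).congr_deriv ?_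
  simp

/-- The lead angle never becomes `0` or `π` before a pursuer meets the target. -/
theorem bodyLos_im_ne_zero (hG : P.FollowsGuidanceLaw G) (h0 : 0 ≤ T) (hT : P.EnRoute T)
    (hi : (P.bodyLos i 0).im ≠ 0) : (P.bodyLos i T).im ≠ 0 := by
  obtain ⟨ρ, hρ, hρR⟩ := hG.exists_pos_le_R h0 hT i
  have hV := P.V_pos i
  -- The imaginary part `q` of `w` satisfies `q' = -cq` with `|c| ≤ 2V/ρ`, so `q²` decays at most
  -- like `exp(-kt)` with `k = 2 · 2V/ρ`.
  set k := 4 * P.V i / ρ with hk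
  have hmono := LocallyLipschitzOn.le_of_ae_deriv_nonneg h0
    (f := fun t => (P.bodyLos i t).im ^ 2 * Real.exp (k * t))
    (((hG.locallyLipschitzOn_bodyLos h0 hT).prodMk
      (LipschitzWith.id.lipschitzOnWith.locallyLipschitzOn)).contDiffAt_comp
      (f := fun p : ℂ × ℝ => p.1.im ^ 2 * Real.exp (k * p.2)) (fun t _ => by
        have h : ContDiff ℝ 1 fun p : ℂ × ℝ => p.1.im := Complex.imCLM.contDiff.comp contDiff_fst
        exact ((h.pow 2).mul (contDiff_const.mul contDiff_snd).exp).contDiffAt))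
    (by
      filter_upwards [hG.ae_hasDerivAt_bodyLos (i := i) h0 hT] with t h ht
      have h1 := hasDerivAt_bodyLos_im (h ht)
      have h2 := ((hasDerivAt_id t).const_mul k).exp
      refine ⟨_, ?_, (h1.pow 2).mul h2⟩
      obtain ⟨κ, hκ, hω⟩ := hG.exists_turnRate_eq (i := i) ht.1.le (hT.mono ht.2.le)
      have hR := hρR t (Ioo_subset_Icc_self ht)
      have hRp := hρ.trans_le hR
      set q := (P.bodyLos i t).im
      have key : |κ * (2 * P.V i) * (P.bodyLos i t).re / P.R i t ^ 2| ≤ k / 2 := by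
        have hre := Complex.abs_re_le_norm (P.bodyLos i t)
        rw [norm_bodyLos] at hre
        rw [abs_div, abs_mul, abs_mul, abs_of_nonneg hκ.1,
          abs_of_pos (by positivity : 0 < 2 * P.V i), abs_of_pos (by positivity : 0 < P.R i t ^ 2)]
        calc κ * (2 * P.V i) * |(P.bodyLos i t).re| / P.R i t ^ 2
            ≤ 1 * (2 * P.V i) * P.R i t / P.R i t ^ 2 := by
              have := hκ.2
              gcongr
          _ = 2 * P.V i / P.R i t := by field_simp
          _ ≤ 2 * P.V i / ρ := by gcongr
          _ = k / 2 := by rw [hk]; ring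
      have h3 := (abs_le.1 key).2
      rw [Complex.normSq_eq_norm_sq, norm_bodyLos] at hω
      have h4 : P.turnRate i t * (P.bodyLos i t).re =
          q * (κ * (2 * P.V i) * (P.bodyLos i t).re / P.R i t ^ 2) := by
        rw [hω]; ring
      rw [h4]
      have he := Real.exp_pos (k * t)
      have h5 : 0 ≤ q ^ 2 * (k - 2 * (κ * (2 * P.V i) * (P.bodyLos i t).re / P.R i t ^ 2)) *
          Real.exp (k * t) := by
        have : 0 ≤ k - 2 * (κ * (2 * P.V i) * (P.bodyLos i t).re / P.R i t ^ 2) := by linarith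
        positivity
      refine h5.trans_eq ?_
      simp
      ring)
  intro h
  simp only [h, mul_zero, Real.exp_zero, mul_one] at hmono
  have : 0 < (P.bodyLos i 0).im ^ 2 := by positivity
  simp at hmono
  exact hi hmono

end FollowsGuidanceLaw

end Pursuit

/-! ### Arrival estimates and leaders -/

namespace Pursuit

variable {n : ℕ} {P : Pursuit n} {G : Digraph (Fin n)} {i l : Fin n} {s t T τ : ℝ}

/-- Estimated moment of interception of pursuer `i`. -/
noncomputable def arrival (P : Pursuit n) (i : Fin n) (t : ℝ) : ℝ := P.tTilde i t + t

theorem IsLeader.not_below (h : P.IsLeader i t) : ¬ P.Below G i t := by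
  rintro ⟨j, -, hj⟩
  exact (h j).not_gt hj

/-- Equality of estimates along the path would make its endpoint a leader too, and a leader is not
below anyone. So leaders never slide. -/
theorem IsLeader.not_tiedToStraight (h : P.IsLeader i t) : ¬ P.TiedToStraight G i t := by
  rintro ⟨k, hk, hb⟩
  have : P.tTilde i t = P.tTilde k t := by
    clear hb
    induction hk with
    | refl => rfl
    | tail _ h2 ih => exact ih.trans h2.2
  have hkl : P.IsLeader k t := fun j => this ▸ h j
  exact hkl.not_below hb

namespace FollowsGuidanceLaw

theorem a_eq_aCirc (hG : P.FollowsGuidanceLaw G) (h0 : 0 ≤ t) (ht : P.EnRoute t)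
    (h : P.IsLeader i t) : P.a i t = P.aCirc i t :=
  ((hG.law i t h0 ht).circular h.not_below).resolve_right fun h' => h.not_tiedToStraight h'.1

theorem locallyLipschitzOn_arrival (hG : P.FollowsGuidanceLaw G) (h0 : 0 ≤ T) (hT : P.EnRoute T)
    (hi : (P.bodyLos i 0).im ≠ 0) : LocallyLipschitzOn (Icc 0 T) (P.arrival i) := by
  have h := ((hG.locallyLipschitzOn_bodyLos (i := i) h0 hT).prodMk
      (LipschitzWith.id.lipschitzOnWith.locallyLipschitzOn)).contDiffAt_comp
      (f := fun p : ℂ × ℝ => circularTime (P.V i) p.1 + p.2) (fun t ht =>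
        (ContDiffAt.comp (P.bodyLos i t, t) (contDiffAt_circularTime (P.V_pos i)
          (hG.bodyLos_im_ne_zero ht.1 (hT.mono ht.2) hi)) contDiffAt_fst).add contDiffAt_snd)
  have he : P.arrival i = fun t => circularTime (P.V i) (P.bodyLos i t) + t := by
    funext t
    rw [arrival, tTilde_eq_circularTime]
  rw [he]
  exact h

/-- The exceptional null set is chosen before `κ`, so `κ` may depend on `t`. -/
theorem ae_hasDerivAt_arrival (hG : P.FollowsGuidanceLaw G) (h0 : 0 ≤ T) (hT : P.EnRoute T)
    (hi : (P.bodyLos i 0).im ≠ 0) : ∀ᵐ t, t ∈ Ioo 0 T → ∀ κ, P.turnRate i t =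
      κ * (2 * P.V i * (P.bodyLos i t).im / Complex.normSq (P.bodyLos i t)) →
      HasDerivAt (P.arrival i) (2 * (1 - κ) *
        (1 - (P.bodyLos i t).re * (P.bodyLos i t).arg / (P.bodyLos i t).im)) t := by
  filter_upwards [hG.ae_hasDerivAt_bodyLos (i := i) h0 hT] with t h ht κ hκ
  have h1 := hasDerivAt_circularTime (P.V_pos i)
    (hG.bodyLos_im_ne_zero ht.1.le (hT.mono ht.2.le) hi) hκ (h ht)
  refine ((h1.add (hasDerivAt_id t)).congr_deriv (by ring)).congr_of_eventuallyEq
    (Eventually.of_forall fun s => ?_)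
  rw [arrival, tTilde_eq_circularTime]
  rfl

theorem arrival_le (hG : P.FollowsGuidanceLaw G) (h0 : 0 ≤ s) (hst : s ≤ T) (hT : P.EnRoute T)
    (hi : (P.bodyLos i 0).im ≠ 0) : P.arrival i s ≤ P.arrival i T := by
  refine LocallyLipschitzOn.le_of_ae_deriv_nonneg hst
    ((hG.locallyLipschitzOn_arrival (h0.trans hst) hT hi).mono (Icc_subset_Icc_left h0)) ?_
  filter_upwards [hG.ae_hasDerivAt_arrival (h0.trans hst) hT hi] with t h ht
  have ht' : t ∈ Ioo 0 T := ⟨h0.trans_lt ht.1, ht.2⟩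
  obtain ⟨κ, hκ, hω⟩ := hG.exists_turnRate_eq (i := i) ht'.1.le (hT.mono ht.2.le)
  refine ⟨_, ?_, h ht' κ hω⟩
  have h1 := Complex.re_mul_arg_div_im_le_one
    (hG.bodyLos_im_ne_zero ht'.1.le (hT.mono ht.2.le) hi)
  exact mul_nonneg (mul_nonneg two_pos.le (sub_nonneg.2 hκ.2)) (sub_nonneg.2 h1)

theorem R_le_mul_tTilde (hG : P.FollowsGuidanceLaw G) (h0 : 0 ≤ t) (ht : P.EnRoute t)
    (hi : (P.bodyLos i 0).im ≠ 0) : P.R i t ≤ P.V i * P.tTilde i t := by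
  rw [← norm_bodyLos, tTilde_eq_circularTime]
  exact norm_le_mul_circularTime (P.V_pos i) (hG.bodyLos_im_ne_zero h0 ht hi)

/-- Nonnegativity lets the maximum of the estimates be handled as a sup norm. -/
theorem arrival_nonneg (hG : P.FollowsGuidanceLaw G) (h0 : 0 ≤ t) (ht : P.EnRoute t)
    (hi : (P.bodyLos i 0).im ≠ 0) : 0 ≤ P.arrival i t := by
  have h := (norm_nonneg _).trans (hG.R_le_mul_tTilde h0 ht hi)
  have := nonneg_of_mul_nonneg_right h (P.V_pos i)
  rw [arrival]
  linarith

/-- The largest estimated moment of interception does not change. -/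
theorem arrival_le_leader (hG : P.FollowsGuidanceLaw G) (h0 : 0 ≤ T) (hT : P.EnRoute T)
    (hi : ∀ i, (P.bodyLos i 0).im ≠ 0) (hl : P.IsLeader l 0) (i : Fin n) :
    P.arrival i T ≤ P.tTilde l 0 := by
  have h := LocallyLipschitzOn.norm_eq_of_ae_deriv_zero h0
    (fun i => hG.locallyLipschitzOn_arrival h0 hT (hi i))
    (fun i t ht => hG.arrival_nonneg ht.1 (hT.mono ht.2) (hi i)) (by
      filter_upwards [ae_all_iff.2 fun i => hG.ae_hasDerivAt_arrival h0 hT (hi i)]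
        with t h ht i hmax
      -- All arrival estimates add the same `t`, so a maximal one belongs to a leader, for which `κ
      -- = 1`.
      have hlead : P.IsLeader i t := fun j => by
        have := hmax j
        rw [arrival, arrival] at this
        linarith
      have ha := hG.a_eq_aCirc ht.1.le (hT.mono ht.2.le) hlead
      have := h i ht 1 (by rw [turnRate, ha, aCirc_div, one_mul])
      simpa using this)
  have h1 : P.arrival i T ≤ ‖fun i => P.arrival i T‖ :=
    (le_abs_self _).trans (norm_le_pi_norm (fun i => P.arrival i T) i)
  refine h1.trans (h.trans_le ?_)
  have h2 : ∀ j, 0 ≤ P.tTilde j 0 := fun j => by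
    have := hG.arrival_nonneg le_rfl (hT.mono h0) (hi j)
    rwa [arrival, add_zero] at this
  refine (pi_norm_le_iff_of_nonneg (h2 l)).2 fun j => ?_
  rw [arrival, add_zero, Real.norm_of_nonneg (h2 j)]
  exact hl j

/-! ### Meeting the target and agreement of the estimates -/

theorem tendsto_R (hG : P.FollowsGuidanceLaw G) (hτ : 0 < τ) :
    Tendsto (P.R i) (𝓝[<] τ) (𝓝 (P.R i τ)) :=
  ((hG.continuousOn_los.continuousAt (Ici_mem_nhds hτ)).norm).tendsto.mono_left nhdsWithin_le_nhds

/-- A pursuer that moves straight before `τ` is not at the target at time `τ`. -/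
theorem not_atTarget_of_straight (hG : P.FollowsGuidanceLaw G) (hs : s ∈ Ico 0 τ)
    (hτ : ∀ t ∈ Ico 0 τ, P.EnRoute t) (hi : (P.bodyLos i 0).im ≠ 0)
    (ha : ∀ t ∈ Ico s τ, P.Below G i t) : ¬ P.AtTarget i τ := by
  have him := hG.bodyLos_im_ne_zero hs.1 (hτ s hs) hi
  -- The absolute imaginary part is the distance from the target to the line of motion, which is
  -- constant on a straight course.
  have h : ∀ t ∈ Ico s τ, |(P.bodyLos i s).im| ≤ P.R i t := by
    intro t ht
    have h0 : 0 ≤ t := hs.1.trans ht.1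
    have hT := hτ t ⟨h0, ht.2⟩
    have hc : (P.bodyLos i t).im = (P.bodyLos i s).im := by
      refine LocallyLipschitzOn.eq_of_ae_deriv_zero ht.1
        (((hG.locallyLipschitzOn_bodyLos h0 hT).mono (Icc_subset_Icc_left hs.1)).contDiffAt_comp
          (f := fun w : ℂ => w.im) fun _ _ => Complex.imCLM.contDiff.contDiffAt) ?_
      filter_upwards [hG.ae_hasDerivAt_bodyLos (i := i) h0 hT] with r hr hrs
      have hr0 : 0 < r := hs.1.trans_lt hrs.1
      have h1 := hasDerivAt_bodyLos_im (hr ⟨hr0, hrs.2⟩)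
      have h2 := (hG.law i r hr0.le (hT.mono hrs.2.le)).straight
        (ha r ⟨hrs.1.le, hrs.2.trans ht.2⟩)
      simpa [turnRate, h2] using h1
    rw [← hc, ← norm_bodyLos]
    exact Complex.abs_im_le_norm _
  have hlim := ge_of_tendsto (hG.tendsto_R (hs.1.trans_lt hs.2))
    (mem_of_superset (Ico_mem_nhdsLT hs.2) h)
  intro hat
  rw [atTarget_iff] at hat
  rw [R, hat, norm_zero] at hlim
  exact him (abs_nonpos_iff.1 hlim)

/-- A pursuer does not meet the target before its estimated moment of interception. -/
theorem not_atTarget_of_lt_arrival (hG : P.FollowsGuidanceLaw G) (hs : s ∈ Ico 0 τ)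
    (hτ : ∀ t ∈ Ico 0 τ, P.EnRoute t) (hi : (P.bodyLos i 0).im ≠ 0)
    (h : τ < P.arrival i s) : ¬ P.AtTarget i τ := by
  intro hat
  have hV := P.V_pos i
  have hpi := Real.pi_pos
  have hτ0 := hs.1.trans_lt hs.2
  have hL : 0 < P.arrival i s - τ := sub_pos.2 h
  have hlim := hG.tendsto_R (i := i) hτ0
  rw [R, atTarget_iff.1 hat, norm_zero] at hlim
  -- Below this distance an arc of at most a half circle takes less than the time `arrival - τ`
  -- still outstanding at `τ`. Hence the target must lie behind or abeam.
  have hev := hlim.eventually_lt_const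
    (show 0 < P.V i * (P.arrival i s - τ) / (Real.pi / 2) by positivity)
  obtain ⟨s', hs', hlt⟩ := mem_nhdsLT_iff_exists_Ico_subset.1
    (inter_mem hev (Ico_mem_nhdsLT hs.2))
  have hpos : ∀ t ∈ Ico s' τ, (P.bodyLos i t).re ≤ 0 := by
    intro t ht
    obtain ⟨hR, hst⟩ := hlt ht
    have h0 : 0 ≤ t := hs.1.trans hst.1
    have hT := hτ t ⟨h0, hst.2⟩
    by_contra! hre
    have h1 := mul_circularTime_le hV (hG.bodyLos_im_ne_zero h0 hT hi) hre.le
    rw [← tTilde_eq_circularTime, norm_bodyLos] at h1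
    have h2 := hG.arrival_le hs.1 hst.1 hT hi
    have h3 : P.arrival i s - τ ≤ P.tTilde i t := by
      rw [arrival] at h2 ⊢
      rw [arrival] at h2
      linarith [hst.2]
    have h4 : P.R i t * (Real.pi / 2) < P.V i * (P.arrival i s - τ) :=
      (lt_div_iff₀ (by positivity)).1 hR
    have := mul_le_mul_of_nonneg_left h3 hV.le
    linarith
  have hs'0 : 0 ≤ s' := hs.1.trans (hlt ⟨le_rfl, hs'⟩).2.1
  -- The squared distance has derivative `-2V Re w`, whatever the turn rate; it is nonnegative here,
  -- so the distance cannot tend to zero.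
  have hge : ∀ t ∈ Ico s' τ, P.R i s' ≤ P.R i t := by
    intro t ht
    have h0 : 0 ≤ t := hs'0.trans ht.1
    have hT := hτ t ⟨h0, ht.2⟩
    have hsq : Complex.normSq (P.bodyLos i s') ≤ Complex.normSq (P.bodyLos i t) := by
      simp only [Complex.normSq_apply]
      refine LocallyLipschitzOn.le_of_ae_deriv_nonneg ht.1
        (f := fun t => (P.bodyLos i t).re * (P.bodyLos i t).re +
          (P.bodyLos i t).im * (P.bodyLos i t).im)
        (((hG.locallyLipschitzOn_bodyLos h0 hT).mono (Icc_subset_Icc_left hs'0)).contDiffAt_comp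
          (f := fun w : ℂ => w.re * w.re + w.im * w.im) fun _ _ => ?_) ?_
      · have h1 : ContDiff ℝ 1 fun z : ℂ => z.im := Complex.imCLM.contDiff
        have h2 : ContDiff ℝ 1 fun z : ℂ => z.re := Complex.reCLM.contDiff
        exact ((h2.mul h2).add (h1.mul h1)).contDiffAt
      · filter_upwards [hG.ae_hasDerivAt_bodyLos (i := i) h0 hT] with r hr hrs
        have hd := hr ⟨hs'0.trans_lt hrs.1, hrs.2⟩
        have h1 := Complex.imCLM.hasFDerivAt.comp_hasDerivAt r hd
        have h2 := Complex.reCLM.hasFDerivAt.comp_hasDerivAt r hd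
        refine ⟨_, ?_, (h2.mul h2).add (h1.mul h1)⟩
        have h3 := hpos r ⟨hrs.1.le, hrs.2.trans ht.2⟩
        simp
        nlinarith
    rw [Complex.normSq_eq_norm_sq, Complex.normSq_eq_norm_sq, norm_bodyLos, norm_bodyLos] at hsq
    exact le_of_sq_le_sq hsq (norm_nonneg _)
  have := ge_of_tendsto hlim (mem_of_superset (Ico_mem_nhdsLT hs') hge)
  exact (hτ s' ⟨hs'0, hs'⟩).los_ne_zero ⟨hs'0, le_rfl⟩ (norm_le_zero_iff.1 this)

/-- A pursuer that is estimated to arrive by `τ` is at the target at time `τ`. -/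
theorem atTarget_of_arrival_le (hG : P.FollowsGuidanceLaw G) (h0 : 0 < τ)
    (hτ : ∀ t ∈ Ico 0 τ, P.EnRoute t) (hi : (P.bodyLos i 0).im ≠ 0)
    (h : ∀ t ∈ Ico 0 τ, P.arrival i t ≤ τ) : P.AtTarget i τ := by
  have hle : ∀ t ∈ Ico 0 τ, P.R i t ≤ P.V i * (τ - t) := fun t ht => by
    refine (hG.R_le_mul_tTilde ht.1 (hτ t ht) hi).trans
      (mul_le_mul_of_nonneg_left ?_ (P.V_pos i).le)
    have := h t ht
    rw [arrival] at this
    linarith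
  have hlim : Tendsto (fun t => P.V i * (τ - t)) (𝓝[<] τ) (𝓝 (P.V i * (τ - τ))) :=
    (Continuous.tendsto (by fun_prop) τ).mono_left nhdsWithin_le_nhds
  have := le_of_tendsto_of_tendsto (hG.tendsto_R h0) hlim
    (mem_of_superset (Ico_mem_nhdsLT h0) hle)
  rw [sub_self, mul_zero] at this
  exact atTarget_iff.2 (norm_le_zero_iff.1 this)

theorem arrival_leader (hG : P.FollowsGuidanceLaw G) (h0 : 0 ≤ T) (hT : P.EnRoute T)
    (hi : ∀ i, (P.bodyLos i 0).im ≠ 0) (hl : P.IsLeader l 0) :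
    P.arrival l T = P.tTilde l 0 := by
  refine le_antisymm (hG.arrival_le_leader h0 hT hi hl l) ?_
  have := hG.arrival_le le_rfl h0 hT (hi l)
  rwa [arrival, add_zero] at this

/-- If no pursuer meets the target before `τ`, and `τ` precedes the moment estimated by the leader,
then no pursuer meets the target at `τ`. -/
theorem not_atTarget_of_enRoute (hG : P.FollowsGuidanceLaw G) (h0 : 0 < τ)
    (hτ : ∀ t ∈ Ico 0 τ, P.EnRoute t) (hi : ∀ i, (P.bodyLos i 0).im ≠ 0)
    (hlt : τ < P.tTilde l 0) {j : Fin n} (hj : Relation.ReflTransGen G.Adj j l) :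
    ¬ P.AtTarget j τ := by
  induction hj using Relation.ReflTransGen.head_induction_on with
  | refl =>
    exact hG.not_atTarget_of_lt_arrival ⟨le_rfl, h0⟩ hτ (hi l) (by rwa [arrival, add_zero])
  | @head p q hpq _ ih =>
    intro hp
    -- Since `q` is absent at `τ`, its estimate exceeds `τ` at some time and, being monotone, from
    -- then on. The estimate of `p` never does, so `p` is below `q` and goes straight.
    obtain ⟨s, hs, hqs⟩ : ∃ s ∈ Ico 0 τ, τ < P.arrival q s := by
      by_contra! hcon
      exact ih (hG.atTarget_of_arrival_le h0 hτ (hi q) hcon)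
    refine hG.not_atTarget_of_straight hs hτ (hi p) (fun t ht => ⟨q, hpq, ?_⟩) hp
    have ht0 : t ∈ Ico 0 τ := ⟨hs.1.trans ht.1, ht.2⟩
    have h1 := hG.arrival_le hs.1 ht.1 (hτ t ht0) (hi q)
    have h2 : P.arrival p t ≤ τ := by
      by_contra! hcon
      exact hG.not_atTarget_of_lt_arrival ht0 hτ (hi p) hcon hp
    have h3 := h2.trans_lt (hqs.trans_le h1)
    rw [arrival, arrival] at h3
    linarith

/-- Otherwise there is a first meeting time, as the meeting times form a closed set; it is positive
because the initial line of sight is nonzero. -/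
theorem enRoute_of_lt (hG : P.FollowsGuidanceLaw G) (hi : ∀ i, (P.bodyLos i 0).im ≠ 0)
    (hreach : ∀ j, Relation.ReflTransGen G.Adj j l)
    (hT : T < P.tTilde l 0) : P.EnRoute T := by
  by_contra hcon
  set S : Set ℝ := Icc 0 T ∩ ⋃ i, {t | P.AtTarget i t} with hS
  have hS' : S = ⋃ i, Icc 0 T ∩ P.los i ⁻¹' {0} := by
    ext t
    simp [hS, atTarget_iff]
  have hclosed : IsClosed S := by
    rw [hS']
    exact isClosed_iUnion_of_finite fun i =>
      (hG.continuousOn_los.mono Icc_subset_Ici_self).preimage_isClosed_of_isClosed isClosed_Icc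
        isClosed_singleton
  have hne : S.Nonempty := by
    simp only [EnRoute, not_forall, not_not] at hcon
    obtain ⟨t, ht, i, hit⟩ := hcon
    exact ⟨t, ht, mem_iUnion.2 ⟨i, hit⟩⟩
  have hbdd : BddBelow S := ⟨0, fun t ht => ht.1.1⟩
  have hmem := hclosed.csInf_mem hne hbdd
  set τ := sInf S with hτdef
  obtain ⟨j, hj⟩ := mem_iUnion.1 hmem.2
  have hj : P.AtTarget j τ := hj
  have hpos : 0 < τ := by
    refine lt_of_le_of_ne hmem.1.1 fun h => hi j ?_
    rw [← h, atTarget_iff] at hj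
    rw [bodyLos, hj, zero_mul, Complex.zero_im]
  have hτ : ∀ t ∈ Ico 0 τ, P.EnRoute t := fun t ht s hs i his => by
    have : s ∈ S := ⟨⟨hs.1, hs.2.trans (ht.2.le.trans hmem.1.2)⟩, mem_iUnion.2 ⟨i, his⟩⟩
    exact (hs.2.trans_lt ht.2).not_ge (csInf_le hbdd this)
  exact hG.not_atTarget_of_enRoute hpos hτ hi (hmem.1.2.trans_lt hT) (hreach j) hj

/-- Every pursuer eventually shares the estimate of the leader. -/
theorem exists_arrival_eq (hG : P.FollowsGuidanceLaw G) (hi : ∀ i, (P.bodyLos i 0).im ≠ 0)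
    (hl : P.IsLeader l 0) (h0 : 0 < P.tTilde l 0)
    (hτ : ∀ t ∈ Ico 0 (P.tTilde l 0), P.EnRoute t) {j : Fin n}
    (hj : Relation.ReflTransGen G.Adj j l) :
    ∃ s ∈ Ico 0 (P.tTilde l 0), ∀ t ∈ Ico s (P.tTilde l 0), P.arrival j t = P.tTilde l 0 := by
  induction hj using Relation.ReflTransGen.head_induction_on with
  | refl => exact ⟨0, ⟨le_rfl, h0⟩, fun t ht => hG.arrival_leader ht.1 (hτ t ht) hi hl⟩
  | @head p q hpq _ ih =>
    obtain ⟨s, hs, hq⟩ := ih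
    have hat : P.AtTarget p (P.tTilde l 0) := hG.atTarget_of_arrival_le h0 hτ (hi p)
      fun t ht => hG.arrival_le_leader ht.1 (hτ t ht) hi hl p
    -- If `p` stayed strictly under the final estimate of `q`, it would go straight and miss,
    -- contradicting `hat`.
    obtain ⟨r, hr, hpr⟩ : ∃ r ∈ Ico s (P.tTilde l 0), P.tTilde l 0 ≤ P.arrival p r := by
      by_contra! hcon
      refine hG.not_atTarget_of_straight hs hτ (hi p) (fun t ht => ⟨q, hpq, ?_⟩) hat
      have h1 := (hcon t ht).trans_eq (hq t ht).symm
      rw [arrival, arrival] at h1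
      linarith
    refine ⟨r, ⟨hs.1.trans hr.1, hr.2⟩, fun t ht => ?_⟩
    have ht0 : t ∈ Ico 0 (P.tTilde l 0) := ⟨hs.1.trans (hr.1.trans ht.1), ht.2⟩
    exact le_antisymm (hG.arrival_le_leader ht0.1 (hτ t ht0) hi hl p)
      (hpr.trans (hG.arrival_le (hs.1.trans hr.1) ht.1 (hτ t ht0) (hi p)))

/-- A pursuer that applies the acceleration of the circular path moves on a circle through the
target. -/
theorem exists_circle (hG : P.FollowsGuidanceLaw G) (hs : s ∈ Ico 0 τ)
    (hτ : ∀ t ∈ Ico 0 τ, P.EnRoute t) (hi : (P.bodyLos i 0).im ≠ 0)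
    (ha : ∀ t ∈ Ico s τ, P.a i t = P.aCirc i t) :
    ∃ cx cy r : ℝ, 0 < r ∧ (P.xT - cx) ^ 2 + (P.yT - cy) ^ 2 = r ^ 2 ∧
      ∀ t ∈ Ico s τ, (P.x i t - cx) ^ 2 + (P.y i t - cy) ^ 2 = r ^ 2 := by
  have hV := P.V_pos i
  -- This is `sin θ / R`, half the signed curvature of the circular path; hence the radius `1 /
  -- (2|k|)` below.
  set k : ℝ → ℝ := fun t => (P.bodyLos i t).im / Complex.normSq (P.bodyLos i t) with hk
  have hω : ∀ t ∈ Ico s τ, P.turnRate i t = 2 * P.V i * k t := fun t ht => by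
    rw [turnRate, ha t ht, aCirc_div, hk, mul_div_assoc]
  have hn : ∀ t ∈ Ico s τ, Complex.normSq (P.bodyLos i t) ≠ 0 := fun t ht h =>
    (hτ t ⟨hs.1.trans ht.1, ht.2⟩).bodyLos_ne_zero ⟨hs.1.trans ht.1, le_rfl⟩
      (Complex.normSq_eq_zero.1 h)
  have hkc : ∀ t ∈ Ico s τ, k t = k s := by
    intro t ht
    have h0 : 0 ≤ t := hs.1.trans ht.1
    have hT := hτ t ⟨h0, ht.2⟩
    have h1 : ContDiff ℝ 1 fun z : ℂ => z.im := Complex.imCLM.contDiff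
    have h2 : ContDiff ℝ 1 fun z : ℂ => z.re := Complex.reCLM.contDiff
    simp only [hk, Complex.normSq_apply] at hω hn ⊢
    refine LocallyLipschitzOn.eq_of_ae_deriv_zero ht.1
      (f := fun t => (P.bodyLos i t).im / ((P.bodyLos i t).re * (P.bodyLos i t).re +
          (P.bodyLos i t).im * (P.bodyLos i t).im))
      (((hG.locallyLipschitzOn_bodyLos h0 hT).mono (Icc_subset_Icc_left hs.1)).contDiffAt_comp
        (f := fun w : ℂ => w.im / (w.re * w.re + w.im * w.im)) fun r hr =>
          h1.contDiffAt.div ((h2.mul h2).add (h1.mul h1)).contDiffAt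
            (hn r ⟨hr.1, hr.2.trans_lt ht.2⟩)) ?_
    filter_upwards [hG.ae_hasDerivAt_bodyLos (i := i) h0 hT] with r hr hrs
    have hr' : r ∈ Ico s τ := ⟨hrs.1.le, hrs.2.trans ht.2⟩
    have hd := hr ⟨hs.1.trans_lt hrs.1, hrs.2⟩
    have h3 := Complex.imCLM.hasFDerivAt.comp_hasDerivAt r hd
    have h4 := Complex.reCLM.hasFDerivAt.comp_hasDerivAt r hd
    refine (h3.div ((h4.mul h4).add (h3.mul h3)) (hn r hr')).congr_deriv ?_
    have hne : (P.bodyLos i r).re ^ 2 + (P.bodyLos i r).im ^ 2 ≠ 0 := by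
      simpa only [sq] using hn r hr'
    simp
    rw [hω r hr']
    left
    field_simp
    ring
  have hks : k s ≠ 0 := div_ne_zero (hG.bodyLos_im_ne_zero hs.1 (hτ s hs) hi)
    (hn s ⟨le_rfl, hs.2⟩)
  -- The vector from the centre of the turning circle to the target; its constancy fixes the centre.
  set b : ℝ → ℂ := fun t => P.los i t -
    Complex.I * (1 / (2 * k s) : ℝ) * Complex.exp (P.γ i t * Complex.I) with hb
  have hbc : ∀ t ∈ Ico s τ, b t = b s := by
    intro t ht
    have h0 : 0 ≤ t := hs.1.trans ht.1
    have hT := hτ t ⟨h0, ht.2⟩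
    refine LocallyLipschitzOn.eq_of_ae_deriv_zero ht.1
      ((((hG.locallyLipschitzOn_los hT).prodMk (hG.locallyLipschitzOn_γ h0 hT)).mono
        (Icc_subset_Icc_left hs.1)).contDiffAt_comp (f := fun p : ℂ × ℝ => p.1 -
          Complex.I * (1 / (2 * k s) : ℝ) * Complex.exp (p.2 * Complex.I)) fun r hr => ?_) ?_
    · have h : ContDiff ℝ 1 fun p : ℂ × ℝ => (p.2 : ℂ) :=
        Complex.ofRealCLM.contDiff.comp contDiff_snd
      exact (contDiff_fst.sub (contDiff_const.mul (h.mul contDiff_const).cexp)).contDiffAt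
    · filter_upwards [hG.ae_hasDerivAt_γ (i := i) h0 hT] with r hr hrs
      have hr0 : 0 < r := hs.1.trans_lt hrs.1
      have hr' : r ∈ Ico s τ := ⟨hrs.1.le, hrs.2.trans ht.2⟩
      have h1 := (hG.hasDerivWithinAt_los (i := i) hr0.le (hT.mono hrs.2.le)).hasDerivAt
        (Ici_mem_nhds hr0)
      have h2 := ((hr ⟨hr0, hrs.2⟩).ofReal_comp.mul_const Complex.I).cexp
      refine (h1.sub (h2.const_mul (Complex.I * (1 / (2 * k s) : ℝ)))).congr_deriv ?_
      rw [hω r hr', hkc r hr']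
      have hkC : (k s : ℂ) ≠ 0 := by exact_mod_cast hks
      push_cast
      field_simp
      linear_combination (-(P.V i : ℂ) * Complex.exp (P.γ i r * Complex.I)) * Complex.I_sq
  have hlos : P.los i s = P.bodyLos i s * Complex.exp (P.γ i s * Complex.I) := by
    rw [bodyLos, mul_assoc, ← Complex.exp_add]
    simp
  have hexp : ∀ t, Complex.normSq (Complex.exp (P.γ i t * Complex.I)) = 1 := fun t => by
    rw [Complex.normSq_eq_norm_sq, Complex.norm_exp_ofReal_mul_I, one_pow]
  refine ⟨P.xT - (b s).re, P.yT - (b s).im, |1 / (2 * k s)|, by positivity, ?_, fun t ht => ?_⟩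
  -- The target lies on the circle because `|w - i/(2k)|² = |w|² - Im w / k + 1/(4k²)` and `Im w / k
  -- = |w|²`.
  · have h : b s = (P.bodyLos i s - Complex.I * (1 / (2 * k s) : ℝ)) *
        Complex.exp (P.γ i s * Complex.I) := by
      simp only [hb]
      rw [hlos]
      ring
    have h1 : Complex.normSq (b s) = (1 / (2 * k s)) ^ 2 := by
      rw [h, Complex.normSq_mul, hexp, mul_one]
      have hne := hn s ⟨le_rfl, hs.2⟩
      have him := hG.bodyLos_im_ne_zero hs.1 (hτ s hs) hi
      simp only [hk, Complex.normSq_apply] at hne ⊢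
      simp
      field_simp
      ring
    rw [sq_abs, ← h1, Complex.normSq_apply]
    ring
  · have h : b t - P.los i t =
        -(Complex.I * (1 / (2 * k s) : ℝ)) * Complex.exp (P.γ i t * Complex.I) := by
      simp only [hb]
      ring
    have h1 : Complex.normSq (b t - P.los i t) = (1 / (2 * k s)) ^ 2 := by
      rw [h, Complex.normSq_mul, hexp, mul_one, Complex.normSq_neg, Complex.normSq_mul,
        Complex.normSq_I, one_mul, Complex.normSq_ofReal, sq]
    rw [sq_abs, ← h1, Complex.normSq_apply, hbc t ht]
    simp only [los, Complex.sub_re, Complex.sub_im]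
    ring

end FollowsGuidanceLaw

end Pursuit

end

/-! ### Conclusion -/

theorem mainTheorem6 {n : ℕ} (P : Pursuit n) (G : Digraph (Fin n)) (l : Fin n)
    (hG : P.FollowsGuidanceLaw G)
    (hθ : ∀ i, P.θ i 0 ≠ 0 ∧ P.θ i 0 ≠ Real.pi)
    (hl : P.IsLeader l 0)
    (hreach : GloballyReachable G l) :
    ∃ tα : ℝ, 0 ≤ tα ∧ tα < P.tTilde l 0 ∧
      ∀ i, P.CircularToTarget i tα (P.tTilde l 0) ∧
        ∀ t ∈ Set.Ico 0 (P.tTilde l 0), ¬ P.AtTarget i t := by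
  -- This also excludes a start at the target, since `arg 0 = 0`.
  have hi : ∀ i, (P.bodyLos i 0).im ≠ 0 := fun i h => by
    rcases le_or_gt 0 (P.bodyLos i 0).re with h1 | h1
    · exact (hθ i).1 (Complex.arg_eq_zero_iff.2 ⟨h1, h⟩)
    · exact (hθ i).2 (Complex.arg_eq_pi_iff.2 ⟨h1, h⟩)
  have hr : ∀ j, Relation.ReflTransGen G.Adj j l := fun j => by
    rcases eq_or_ne j l with rfl | h
    · exact Relation.ReflTransGen.refl
    · exact hreach j h
  have h00 : P.EnRoute 0 := fun s hs i h => by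
    obtain rfl : s = 0 := le_antisymm hs.2 hs.1
    exact hi i (by rw [Pursuit.bodyLos, Pursuit.atTarget_iff.1 h, zero_mul, Complex.zero_im])
  have h0 : 0 < P.tTilde l 0 := by
    have h1 := hG.R_le_mul_tTilde le_rfl h00 (hi l)
    have h2 : 0 < P.R l 0 := norm_pos_iff.2 (h00.los_ne_zero ⟨le_rfl, le_rfl⟩)
    exact pos_of_mul_pos_right (h2.trans_le h1) (P.V_pos l).le
  have hτ : ∀ t ∈ Set.Ico 0 (P.tTilde l 0), P.EnRoute t := fun t ht =>
    hG.enRoute_of_lt hi hr ht.2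
  choose s hs hsl using fun j => hG.exists_arrival_eq hi hl h0 hτ (hr j)
  have : Nonempty (Fin n) := ⟨l⟩
  obtain ⟨m, hm⟩ := Finite.exists_max s
  refine ⟨s m, (hs m).1, (hs m).2, fun i => ⟨?_, fun t ht => hτ t ht t ⟨ht.1, le_rfl⟩ i⟩⟩
  have hat : P.AtTarget i (P.tTilde l 0) := hG.atTarget_of_arrival_le h0 hτ (hi i)
    fun t ht => hG.arrival_le_leader ht.1 (hτ t ht) hi hl i
  have ha : ∀ t ∈ Set.Ico (s m) (P.tTilde l 0), P.a i t = P.aCirc i t := fun t ht => by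
    have ht0 : t ∈ Set.Ico 0 (P.tTilde l 0) := ⟨(hs m).1.trans ht.1, ht.2⟩
    -- After the last agreement time all estimates coincide, so every pursuer is a leader.
    refine hG.a_eq_aCirc ht0.1 (hτ t ht0) fun j => ?_
    have h1 := (hsl j t ⟨(hm j).trans ht.1, ht.2⟩).trans
      (hsl i t ⟨(hm i).trans ht.1, ht.2⟩).symm
    rw [Pursuit.arrival, Pursuit.arrival] at h1
    linarith
  refine ⟨ha, ?_, hat⟩
  obtain ⟨cx, cy, r, h1, h2, h3⟩ := hG.exists_circle (hs m) hτ (hi i) ha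
  refine ⟨cx, cy, r, h1, h2, fun t ht => ?_⟩
  rcases ht.2.eq_or_lt with rfl | h
  · rw [hat.1, hat.2, h2]
  · exact h3 t ⟨ht.1, h⟩
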